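/- A presentation of a compact metric space $(X,d)$ is a pair of programs together with a naming of points $a_0,a_1,a_2,\ldots\in X$ by natural numbers such that the first program, given $i,j\in\mathbb N$ and a rational $\varepsilon>0$, halts and outputs a rational number within $\varepsilon$ of $d(a_i,a_j)$, and the second program, given a rational $\varepsilon>0$, halts and outputs a finite list $i_1,\ldots,i_k$ such that $\{a_{i_1},\ldots,a_{i_k}\}$ is an $\varepsilon$-net of $X$, i.e. every point of $X$ is at distance less than $\varepsilon$ from one of these points. A compact metric space that has a presentation is called a constructive compact space; it is determined up to isometry by the pair of programs. Let $n\ge 1$. There is no algorithm that, given the pair of programs of a presentation of an arbitrary constructive compact space $X$, always halts and correctly decides whether $\pi_n$ of $X$ is trivial, that is, whether $\pi_n(X,x)$ is trivial for every $x\in X$. Likewise there is no algorithm that, given such a pair of programs and a number $i$ naming a base point $a_i$, always halts and correctly decides whether $\pi_n(X,a_i)$ is trivial. (In both cases nothing is required of the algorithm on inputs that do not arise from a presentation.) -/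

import Mathlib

open Topology Encodable
open Nat.Partrec (Code)

/-- The nonnegative rational number `p / (q + 1)` named by a pair `(p, q)` of natural numbers. -/
noncomputable def ratOf (r : ℕ × ℕ) : ℝ := (r.1 : ℝ) / ((r.2 : ℝ) + 1)

/-- The positive rational number `(p + 1) / (q + 1)` named by a pair `(p, q)` of natural numbers. -/
noncomputable def posRatOf (r : ℕ × ℕ) : ℝ := ((r.1 : ℝ) + 1) / ((r.2 : ℝ) + 1)

/-- The (finite) set of the points `a i`, `i ∈ l`, is an `ε`-net of `X`. -/
def IsNet {X : Type*} [MetricSpace X] (a : ℕ → X) (l : List ℕ) (ε : ℝ) : Prop :=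
  ∀ x : X, ∃ i ∈ l, dist x (a i) < ε

/-- The pair of programs `p` presents the metric space `X` as a constructive space with finite
nets, where the natural number `i` is the name of the point `a i` of `X`:

* the first program, given the names of two points and a positive rational `ε`, halts with a
  rational approximation, up to `ε`, of their distance;
* the second program, given a positive rational `ε`, halts with (the list of names of) a finite
  `ε`-net of `X`. -/
structure Presents (p : Code × Code) {X : Type*} [MetricSpace X] (a : ℕ → X) : Prop where
  dist_spec : ∀ (i j : ℕ) (ε : ℕ × ℕ), ∃ r : ℕ × ℕ,
    encode r ∈ p.1.eval (encode ((i, j), ε)) ∧ |ratOf r - dist (a i) (a j)| ≤ posRatOf ε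
  net_spec : ∀ ε : ℕ × ℕ, ∃ l : List ℕ,
    encode l ∈ p.2.eval (encode ε) ∧ IsNet a l (posRatOf ε)

/-- The procedure `Q` halts on every presentation of a compact metric space `X` and tells correctly
whether `π_n` of `X` is trivial (at every base point). -/
def DecidesTrivialPi (n : ℕ) (Q : Code × Code →. Bool) : Prop :=
  ∀ (p : Code × Code) (X : Type) [MetricSpace X] [CompactSpace X] (a : ℕ → X), Presents p a →
    ∃ b ∈ Q p, (b = true ↔ ∀ x : X, Subsingleton (π_ n X x))

/-- The procedure `Q` halts on every presentation of a compact metric space `X` together with the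
name `i` of a base point, and tells correctly whether `π_n` of `X` at this base point is trivial. -/
def DecidesTrivialPiAt (n : ℕ) (Q : (Code × Code) × ℕ →. Bool) : Prop :=
  ∀ (p : Code × Code) (X : Type) [MetricSpace X] [CompactSpace X] (a : ℕ → X), Presents p a →
    ∀ i : ℕ, ∃ b ∈ Q (p, i), (b = true ↔ Subsingleton (π_ n X (a i)))

/-! The halting problem reduces to both questions. To a program `e` attach the pinched cube, an
`n`-sphere obtained from the cube by collapsing its boundary, scaled by `1 / (t + 1)` if `e` halts
at step `t` and by `0` if it never halts (`haltScale`). Running `e` for `N` steps gives the scale up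
to `1 / (N + 1)`, whether or not `e` halts, so distances and nets are computable uniformly in `e`
(`exists_computable_presentation`), while vanishing of the scale is undecidable
(`not_decides_halting`). With scale `0` the space is a point and `π_n` is trivial; otherwise it is a
sphere and `π_n` is nontrivial at the origin (`not_subsingleton_pi_pinchedCube`).

The topological input is that the collapse map is not null-homotopic. A null-homotopy would give a
nowhere zero map on a box whose boundary behaviour contradicts Brouwer's theorem
(`exists_pos_smul_of_ne_zero`). Brouwer's theorem is proved analytically: for a `C¹` retraction `r`
of the ball `B` onto its sphere, the integral over `B` of the Jacobian of `x + t (r x - x)` is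
polynomial in `t`, equals the volume of `B` for small `t`, and is `0` at `t = 1`. -/

/-! ### No `C¹` retraction of the ball onto the sphere. -/

section Brouwer

open Metric MeasureTheory Set
open scoped RealInnerProductSpace

variable {E : Type*} [NormedAddCommGroup E] [InnerProductSpace ℝ E] [FiniteDimensional ℝ E]

/-- The determinant of `1 + t A` is a polynomial in `t`. -/
theorem exists_polynomial_det_one_add_smul {V : Type*} [AddCommGroup V] [Module ℝ V]
    [FiniteDimensional ℝ V] (A : V →ₗ[ℝ] V) :
    ∃ q : Polynomial ℝ, q.natDegree ≤ Module.finrank ℝ V ∧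
      ∀ t : ℝ, q.eval t = LinearMap.det (1 + t • A) := by
  classical
  let b := Module.finBasis ℝ V
  refine ⟨((Polynomial.X : Polynomial ℝ) • (LinearMap.toMatrix b b A).map Polynomial.C +
    (1 : Matrix (Fin (Module.finrank ℝ V)) (Fin (Module.finrank ℝ V)) ℝ).map Polynomial.C).det,
    ?_, fun t => ?_⟩
  · simpa using Polynomial.natDegree_det_X_add_C_le (LinearMap.toMatrix b b A) 1
  · rw [← LinearMap.det_toMatrix b, ← Polynomial.coe_evalRingHom, RingHom.map_det]
    congr 1
    ext i j
    by_cases hij : i = j <;> simp [LinearMap.toMatrix_one, hij] <;> ring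

/-- A polynomial identity in `t` for integrals of determinants extends from small `t` to `t = 1`. -/
theorem integral_det_one_add_eq {V : Type*} [NormedAddCommGroup V] [NormedSpace ℝ V]
    [FiniteDimensional ℝ V] {α : Type*} [MeasurableSpace α] {μ : Measure α} {A : α → V →L[ℝ] V}
    {c δ : ℝ} (hδ : 0 < δ) (hint : ∀ t : ℝ, Integrable (fun x => (1 + t • A x).det) μ)
    (h : ∀ t : ℝ, 0 < t → t < δ → ∫ x, (1 + t • A x).det ∂μ = c) :
    ∫ x, (1 + A x).det ∂μ = c := by
  choose q hq1 hq2 using fun x => exists_polynomial_det_one_add_smul (A x : V →ₗ[ℝ] V)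
  have hq3 : ∀ x t, (q x).eval t = (1 + t • A x).det := fun x t => hq2 x t
  set d := Module.finrank ℝ V
  set s := Finset.range (d + 1)
  -- These are `d + 1` distinct nodes inside `(0, δ)`. Interpolation there gives the value at `1` as
  -- a fixed linear combination of values at small `t`, and this passes through the integral.
  let v : ℕ → ℝ := fun i => δ / (i + 2)
  have hv : Set.InjOn v s := by
    intro i _ j _ hij
    have h1 : (0 : ℝ) < (i : ℝ) + 2 := by positivity
    have h2 : (0 : ℝ) < (j : ℝ) + 2 := by positivity
    simp only [v] at hij
    field_simp at hij
    exact_mod_cast (by linarith : (i : ℝ) = j)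
  have hv0 : ∀ i, 0 < v i := fun i => by positivity
  have hv1 : ∀ i, v i < δ := fun i => by
    simp only [v]
    rw [div_lt_iff₀ (by positivity)]
    have : (0 : ℝ) ≤ (i : ℝ) := by positivity
    nlinarith
  have key : ∀ p : Polynomial ℝ, p.natDegree ≤ d →
      p.eval 1 = ∑ i ∈ s, p.eval (v i) * (Lagrange.basis s v i).eval 1 := by
    intro p hp
    have h1 : p.degree < s.card := by
      rw [Finset.card_range]
      exact lt_of_le_of_lt Polynomial.degree_le_natDegree (by exact_mod_cast Nat.lt_succ_of_le hp)
    conv_lhs => rw [Lagrange.eq_interpolate hv h1]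
    simp [Lagrange.interpolate_apply, Polynomial.eval_finsetSum]
  have h1 : ∀ x, (1 + A x).det =
      ∑ i ∈ s, (1 + v i • A x).det * (Lagrange.basis s v i).eval 1 := by
    intro x
    have := key (q x) (hq1 x)
    simpa only [hq3, one_smul] using this
  simp_rw [h1]
  rw [integral_finsetSum _ fun i _ => (hint _).mul_const _]
  simp_rw [integral_mul_const, h _ (hv0 _) (hv1 _)]
  have := key (Polynomial.C c) (by simp)
  simpa using this.symm


/-- A Lipschitz map on the closed unit ball that vanishes on the unit sphere is Lipschitz when
extended by zero. -/
theorem lipschitzWith_indicator_closedBall {V F : Type*} [NormedAddCommGroup V] [NormedSpace ℝ V]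
    [NormedAddCommGroup F] {g : V → F} {K : NNReal}
    (hg : LipschitzOnWith K g (closedBall 0 1)) (h0 : ∀ x, ‖x‖ = 1 → g x = 0) :
    LipschitzWith K (indicator (closedBall 0 1) g) := by
  have key : ∀ x y : V, x ∈ closedBall (0 : V) 1 → y ∉ closedBall (0 : V) 1 →
      dist (g x) 0 ≤ K * dist x y := by
    intro x y hx hy
    simp only [mem_closedBall, dist_zero_right, not_le] at hx hy
    -- The segment leaves the ball through a point of the sphere, where `g` vanishes.
    obtain ⟨z, hz, hz1⟩ : ∃ z ∈ segment ℝ x y, ‖z‖ = 1 := by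
      have h := (convex_segment (𝕜 := ℝ) x y).isPreconnected.intermediate_value
        (left_mem_segment ℝ x y) (right_mem_segment ℝ x y) continuous_norm.continuousOn
      exact h ⟨hx, hy.le⟩
    have h1 := hg.dist_le_mul x (by simpa using hx) z (by simp [hz1])
    rw [h0 z hz1] at h1
    refine h1.trans (mul_le_mul_of_nonneg_left ?_ K.2)
    have := dist_add_dist_of_mem_segment hz
    linarith [dist_nonneg (x := z) (y := y)]
  refine LipschitzWith.of_dist_le_mul fun x y => ?_
  by_cases hx : x ∈ closedBall (0 : V) 1 <;> by_cases hy : y ∈ closedBall (0 : V) 1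
  · simpa [indicator_of_mem, hx, hy] using hg.dist_le_mul x hx y hy
  · rw [indicator_of_mem hx, indicator_of_notMem hy]
    exact key x y hx hy
  · rw [indicator_of_notMem hx, indicator_of_mem hy, dist_comm, dist_comm x y]
    exact key y x hy hx
  · rw [indicator_of_notMem hx, indicator_of_notMem hy, dist_self]
    positivity

/-- If `g` is `K`-Lipschitz, vanishes off the unit ball and `t K < 1`, and `id + t g` maps the closed
unit ball to itself, then it does so bijectively. -/
theorem bijOn_id_add_smul {V : Type*} [NormedAddCommGroup V] [NormedSpace ℝ V]
    [CompleteSpace V] {g : V → V} {K : NNReal} (hg : LipschitzWith K g)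
    (h0 : ∀ x, 1 < ‖x‖ → g x = 0) {t : ℝ} (ht : 0 ≤ t) (htK : t * K < 1)
    (hmaps : MapsTo (fun x => x + t • g x) (closedBall 0 1) (closedBall 0 1)) :
    BijOn (fun x => x + t • g x) (closedBall 0 1) (closedBall 0 1) := by
  refine ⟨hmaps, fun x _ y _ hxy => ?_, fun y hy => ?_⟩
  · by_contra hne
    have hpos : 0 < dist x y := dist_pos.2 hne
    have h1 : x - y = t • (g y - g x) := by
      rw [smul_sub]
      simp only at hxy
      rw [sub_eq_sub_iff_add_eq_add, hxy]
      abel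
    have h2 : dist x y ≤ t * (K * dist x y) := by
      calc dist x y = t * dist (g x) (g y) := by
            rw [dist_eq_norm, h1, norm_smul, Real.norm_of_nonneg ht, dist_comm, dist_eq_norm]
        _ ≤ _ := mul_le_mul_of_nonneg_left (hg.dist_le_mul x y) ht
    nlinarith
  -- Preimages of `y` are the fixed points of this contraction of the whole space. One outside the
  -- ball would equal `y`, since `g` vanishes there.
  · let φ : V → V := fun x => y - t • g x
    have hφ : ContractingWith (t.toNNReal * K) φ := by
      refine ⟨by simpa [← NNReal.coe_lt_coe, ht] using htK,
        LipschitzWith.of_dist_le_mul fun a b => ?_⟩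
      simp only [φ, dist_sub_left, dist_smul₀, Real.norm_of_nonneg ht]
      refine (mul_le_mul_of_nonneg_left (hg.dist_le_mul a b) ht).trans_eq ?_
      rw [NNReal.coe_mul, Real.coe_toNNReal t ht, mul_assoc]
    have hfix : φ (hφ.fixedPoint φ) = hφ.fixedPoint φ := hφ.fixedPoint_isFixedPt
    set x := hφ.fixedPoint φ
    have hx : x + t • g x = y := (sub_eq_iff_eq_add.1 hfix).symm
    refine ⟨x, ?_, hx⟩
    by_contra hx1
    simp only [mem_closedBall, dist_zero_right, not_le] at hx1
    rw [h0 x hx1, smul_zero, add_zero] at hx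
    rw [mem_closedBall, dist_zero_right, ← hx] at hy
    linarith

/-- A differentiable map into the unit sphere has singular derivative. -/
theorem det_eq_zero_of_norm_eq_one {r : E → E} {r' : E →L[ℝ] E} {s : Set E} {x : E}
    (hs : UniqueDiffWithinAt ℝ s x) (hx : x ∈ s) (hr : HasFDerivWithinAt r r' s x)
    (h1 : ∀ y ∈ s, ‖r y‖ = 1) : r'.det = 0 := by
  have hd := hr.inner ℝ hr
  have hc : HasFDerivWithinAt (fun y => ⟪r y, r y⟫) (0 : E →L[ℝ] ℝ) s x := by
    refine (hasFDerivWithinAt_const (1 : ℝ) x s).congr (fun y hy => ?_) ?_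
    · rw [real_inner_self_eq_norm_sq, h1 y hy, one_pow]
    · rw [real_inner_self_eq_norm_sq, h1 x hx, one_pow]
  have heq := hs.eq hd hc
  -- Differentiating `‖r‖ ^ 2 = 1` shows that the range of `r'` is orthogonal to `r x`, so `r'` is
  -- not surjective.
  have horth : ∀ v, ⟪r x, r' v⟫ = 0 := by
    intro v
    have := congrArg (fun L : E →L[ℝ] ℝ => L v) heq
    simp [real_inner_comm] at this
    simpa [real_inner_comm] using this
  by_contra hdet
  have hu : IsUnit (r' : E →ₗ[ℝ] E) := by
    rw [LinearMap.isUnit_iff_isUnit_det]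
    exact isUnit_iff_ne_zero.2 hdet
  obtain ⟨v, hv⟩ := ((Module.End.isUnit_iff _).1 hu).2 (r x)
  have h2 := horth v
  simp only [ContinuousLinearMap.coe_coe] at hv
  rw [hv, real_inner_self_eq_norm_sq, h1 x hx] at h2
  norm_num at h2

/-- There is no `C¹` retraction of the closed unit ball onto the unit sphere. -/
theorem not_exists_contDiff_retraction {r : E → E}
    (hr : ∀ x ∈ closedBall (0 : E) 1, ContDiffAt ℝ 1 r x)
    (h1 : ∀ x ∈ closedBall (0 : E) 1, ‖r x‖ = 1) (hid : ∀ x, ‖x‖ = 1 → r x = x) : False := by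
  borelize E
  let μ : Measure E := Measure.addHaar
  set B := closedBall (0 : E) 1 with hB
  have hBc : IsCompact B := isCompact_closedBall 0 1
  have hBconv : Convex ℝ B := convex_closedBall 0 1
  have hg : ContDiffOn ℝ 1 (fun x => r x - x) B := fun x hx =>
    ((hr x hx).sub contDiffAt_id).contDiffWithinAt
  obtain ⟨K, hK⟩ := hg.exists_lipschitzOnWith one_ne_zero hBconv hBc
  have hKG := lipschitzWith_indicator_closedBall hK fun x hx => by simp [hid x hx]
  set A : E → E →L[ℝ] E := fun x => fderiv ℝ r x - 1 with hA
  have hAcont : ContinuousOn A B := fun x hx =>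
    (((hr x hx).fderiv_right (m := 0) (by simp)).continuousAt.sub
      continuousAt_const).continuousWithinAt
  have hderiv : ∀ x ∈ B, HasFDerivAt r (fderiv ℝ r x) x := fun x hx =>
    ((hr x hx).differentiableAt one_ne_zero).hasFDerivAt
  have hdetcont : Continuous fun M : E →L[ℝ] E => M.det := ContinuousLinearMap.continuous_det
  have hint : ∀ t : ℝ, Integrable (fun x => (1 + t • A x).det) (μ.restrict B) := by
    intro t
    refine ContinuousOn.integrableOn_compact hBc ?_
    exact hdetcont.comp_continuousOn (continuousOn_const.add (hAcont.const_smul t))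
  obtain ⟨C, hC⟩ := hBc.exists_bound_of_continuousOn hAcont
  obtain ⟨η, hη, hdet⟩ : ∃ η > 0, ∀ M : E →L[ℝ] E, dist M 1 < η → 0 < M.det := by
    have : ∀ᶠ M in 𝓝 (1 : E →L[ℝ] E), 0 < M.det := by
      refine hdetcont.continuousAt.eventually (lt_mem_nhds ?_)
      simp [ContinuousLinearMap.det]
    exact Metric.eventually_nhds_iff.1 this
  -- The three bounds keep `x + t (r x - x)` in the convex ball, make it bijective there, and make
  -- its Jacobian positive.
  set δ : ℝ := min 1 (min (1 / (K + 1)) (η / (|C| + 1))) with hδ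
  have hδ0 : 0 < δ := by positivity
  have hvol : ∀ t : ℝ, 0 < t → t < δ → ∫ x, (1 + t • A x).det ∂(μ.restrict B) = μ.real B := by
    intro t ht htδ
    have ht1 : t < 1 := htδ.trans_le (min_le_left _ _)
    have htK : t * K < 1 := by
      have : t < 1 / (K + 1) := htδ.trans_le ((min_le_right _ _).trans (min_le_left _ _))
      rw [lt_div_iff₀ (by positivity)] at this
      nlinarith
    have htC : t * (|C| + 1) < η := by
      have : t < η / (|C| + 1) := htδ.trans_le ((min_le_right _ _).trans (min_le_right _ _))
      rwa [lt_div_iff₀ (by positivity)] at this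
    have heq : ∀ x ∈ B, x + t • indicator B (fun x => r x - x) x = x + t • (r x - x) :=
      fun x hx => by rw [indicator_of_mem hx]
    have hbij := bijOn_id_add_smul hKG (fun x hx => indicator_of_notMem (by simpa using hx) _)
      ht.le htK (fun x hx => by
        simp only
        rw [heq x hx]
        have := hBconv hx (show r x ∈ B by simp [hB, h1 x hx]) (sub_nonneg.2 ht1.le) ht.le
          (sub_add_cancel 1 t)
        convert this using 1
        rw [smul_sub, sub_smul, one_smul]
        abel)
    have hbij' : BijOn (fun x => x + t • (r x - x)) B B := hbij.congr heq
    have hfd : ∀ x ∈ B, HasFDerivWithinAt (fun x => x + t • (r x - x)) (1 + t • A x) B x :=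
      fun x hx => ((hasFDerivAt_id x).add
        (((hderiv x hx).sub (hasFDerivAt_id x)).const_smul t)).hasFDerivWithinAt
    have hchange := integral_image_eq_integral_abs_det_fderiv_smul μ
      measurableSet_closedBall hfd hbij'.injOn (fun _ => (1 : ℝ))
    rw [hbij'.image_eq] at hchange
    rw [show μ.real B = ∫ _ in B, (1 : ℝ) ∂μ by simp, hchange]
    refine setIntegral_congr_fun measurableSet_closedBall fun x hx => ?_
    have hpos : 0 < (1 + t • A x).det := by
      refine hdet _ ?_
      rw [dist_eq_norm, add_sub_cancel_left, norm_smul, Real.norm_of_nonneg ht.le]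
      refine lt_of_le_of_lt (mul_le_mul_of_nonneg_left ?_ ht.le) htC
      exact (hC x hx).trans ((le_abs_self C).trans (by linarith))
    simp [abs_of_pos hpos]
  have hfin := integral_det_one_add_eq hδ0 hint hvol
  have hzero : ∫ x, (1 + A x).det ∂(μ.restrict B) = 0 := by
    rw [setIntegral_congr_fun (g := fun _ => (0 : ℝ)) measurableSet_closedBall]
    · simp
    intro x hx
    have hU : UniqueDiffWithinAt ℝ B x := by
      refine uniqueDiffWithinAt_convex hBconv ?_ (subset_closure hx)
      exact ⟨0, ball_subset_interior_closedBall (mem_ball_self one_pos)⟩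
    simp only [hA, add_sub_cancel]
    exact det_eq_zero_of_norm_eq_one hU hx (hderiv x hx).hasFDerivWithinAt h1
  rw [hzero] at hfin
  have : 0 < μ.real B := by
    refine ENNReal.toReal_pos (measure_closedBall_pos μ 0 one_pos).ne' hBc.measure_lt_top.ne
  linarith

end Brouwer

/-! ### Brouwer's fixed point theorem. -/

section FixedPoint

open Metric Set
open scoped RealInnerProductSpace ContDiff

variable {E : Type*} [NormedAddCommGroup E] [InnerProductSpace ℝ E] [FiniteDimensional ℝ E]

/-- A smooth map of the closed unit ball into the open unit ball has a fixed point. -/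
theorem exists_fixedPoint_of_contDiff {P : E → E} (hP : ContDiff ℝ 1 P)
    (hP1 : ∀ x ∈ closedBall (0 : E) 1, ‖P x‖ < 1) : ∃ x ∈ closedBall (0 : E) 1, P x = x := by
  by_contra! hne
  let u : E → E := fun x => x - P x
  let a : E → ℝ := fun x => ⟪x, u x⟫
  let Δ : E → ℝ := fun x => a x ^ 2 + ‖u x‖ ^ 2 * (1 - ‖x‖ ^ 2)
  -- The larger root of `‖x + s u‖ ^ 2 = 1`: the ray from `P x` through `x` is followed to the
  -- sphere.
  let s : E → ℝ := fun x => (√(Δ x) - a x) / ‖u x‖ ^ 2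
  have hu : ContDiff ℝ 1 u := contDiff_id.sub hP
  have ha : ContDiff ℝ 1 a := contDiff_id.inner ℝ hu
  have hΔ : ContDiff ℝ 1 Δ :=
    (ha.pow 2).add ((hu.norm_sq ℝ).mul (contDiff_const.sub (contDiff_id.norm_sq ℝ)))
  have hu0 : ∀ x ∈ closedBall (0 : E) 1, 0 < ‖u x‖ ^ 2 := fun x hx => by
    have : u x ≠ 0 := sub_ne_zero.2 (hne x hx).symm
    positivity
  have ha0 : ∀ x, ‖x‖ = 1 → 0 < a x := fun x hx => by
    have h1 := real_inner_le_norm x (P x)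
    have h2 := hP1 x (by simp [hx])
    simp only [a, u, inner_sub_right, real_inner_self_eq_norm_sq, hx] at h1 ⊢
    linarith
  have hΔ0 : ∀ x ∈ closedBall (0 : E) 1, 0 < Δ x := fun x hx => by
    have hx1 : ‖x‖ ≤ 1 := by simpa using hx
    rcases hx1.eq_or_lt with h | h
    · have := ha0 x h
      simp only [Δ, h]
      norm_num
      positivity
    · have h1 : 0 < 1 - ‖x‖ ^ 2 := by nlinarith [norm_nonneg x]
      have := hu0 x hx
      positivity
  refine not_exists_contDiff_retraction (r := fun x => x + s x • u x) ?_ ?_ ?_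
  · intro x hx
    refine contDiffAt_id.add (ContDiffAt.smul ?_ hu.contDiffAt)
    exact ((hΔ.contDiffAt.sqrt (hΔ0 x hx).ne').sub ha.contDiffAt).div
      (hu.norm_sq ℝ).contDiffAt (hu0 x hx).ne'
  · intro x hx
    have h1 : ‖x + s x • u x‖ ^ 2 = ‖x‖ ^ 2 + 2 * (s x * a x) + s x ^ 2 * ‖u x‖ ^ 2 := by
      rw [norm_add_sq_real, inner_smul_right, norm_smul, mul_pow, Real.norm_eq_abs, sq_abs]
    have h2 : s x * ‖u x‖ ^ 2 = √(Δ x) - a x := div_mul_cancel₀ _ (hu0 x hx).ne'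
    have h3 : √(Δ x) ^ 2 = a x ^ 2 + ‖u x‖ ^ 2 * (1 - ‖x‖ ^ 2) := Real.sq_sqrt (hΔ0 x hx).le
    have h4 : ‖u x‖ ^ 2 * (‖x + s x • u x‖ ^ 2 - 1) = 0 := by
      rw [h1]
      have h5 : √(Δ x) = s x * ‖u x‖ ^ 2 + a x := by linarith
      rw [h5] at h3
      linear_combination h3
    have h6 := (mul_eq_zero.1 h4).resolve_left (hu0 x hx).ne'
    rw [sub_eq_zero] at h6
    exact (pow_eq_one_iff_of_nonneg (norm_nonneg _) two_ne_zero).1 h6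
  · intro x hx
    have h1 : Δ x = a x ^ 2 := by simp [Δ, hx]
    have h2 : s x = 0 := by simp [s, h1, Real.sqrt_sq (ha0 x hx).le]
    simp [h2]

/-- **Brouwer's fixed point theorem** for the closed unit ball of a Euclidean space. -/
theorem exists_fixedPoint_of_inner {f : E → E} (hf : Continuous f) (hf1 : ∀ x, ‖f x‖ ≤ 1) :
    ∃ x, f x = x := by
  by_contra! hne
  have hBc : IsCompact (closedBall (0 : E) 1) := isCompact_closedBall 0 1
  obtain ⟨x₀, hx₀, hmin⟩ := hBc.exists_isMinOn (f := fun x => ‖x - f x‖) ⟨0, by simp⟩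
    (continuous_id.sub hf).norm.continuousOn
  rw [isMinOn_iff] at hmin
  set m := ‖x₀ - f x₀‖ with hm
  have hm0 : 0 < m := norm_pos_iff.2 (sub_ne_zero.2 (hne x₀).symm)
  set ε := m / 3 with hε
  have hε0 : 0 < ε := by positivity
  obtain ⟨g, hg, hgf⟩ : ∃ g : E → E, ContDiff ℝ 1 g ∧
      ∀ x ∈ closedBall (0 : E) 1, ‖g x - f x‖ < ε := by
    have hd := ContinuousMap.dense_setOfPred_contDiff (E := E) (F := E)
    have := (mem_closure_iff_nhds_basis (nhds_basis_uniformity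
      uniformity_basis_dist.compactConvergenceUniformity)).1 (hd ⟨f, hf⟩)
      (closedBall (0 : E) 1, ε) ⟨hBc, hε0⟩
    obtain ⟨g, hg1, hg2⟩ := this
    replace hg1 : ContDiff ℝ ∞ g := by simpa using hg1
    refine ⟨g, hg1.of_le (by exact_mod_cast le_top), fun x hx => ?_⟩
    have := hg2 x hx
    simpa [dist_eq_norm, norm_sub_rev] using this
  have h12 : 0 < 1 + 2 * ε := by positivity
  -- Here `‖g x‖ < 1 + ε`, so the rescaled map enters the open ball. Its fixed point is displaced by
  -- `f` by less than `ε + 2 * ε = m`.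
  obtain ⟨x, hx, hfix⟩ := exists_fixedPoint_of_contDiff (P := fun x => (1 + 2 * ε)⁻¹ • g x)
    (hg.const_smul _) (fun x hx => by
      rw [norm_smul, Real.norm_of_nonneg (by positivity), inv_mul_lt_iff₀ h12]
      have h1 := norm_le_norm_add_norm_sub' (g x) (f x)
      linarith [hf1 x, hgf x hx])
  have h1 : g x = (1 + 2 * ε) • x :=
    (inv_smul_eq_iff₀ h12.ne').1 hfix
  have h2 : x - f x = (g x - f x) - (2 * ε) • x := by
    rw [h1, add_smul, one_smul]
    abel
  have h3 := hmin x hx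
  rw [h2] at h3
  have h4 := norm_sub_le (g x - f x) ((2 * ε) • x)
  rw [norm_smul, Real.norm_of_nonneg (by positivity)] at h4
  have h5 : ‖x‖ ≤ 1 := by simpa using hx
  have h6 := hgf x hx
  nlinarith

/-- **Brouwer's fixed point theorem** for the closed unit ball of a normed space. -/
theorem exists_fixedPoint_of_norm_le_one {V : Type*} [NormedAddCommGroup V] [NormedSpace ℝ V]
    [FiniteDimensional ℝ V] {f : V → V} (hf : Continuous f) (hf1 : ∀ x, ‖f x‖ ≤ 1) :
    ∃ x, f x = x := by
  let L : V ≃L[ℝ] EuclideanSpace ℝ (Fin (Module.finrank ℝ V)) := toEuclidean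
  obtain ⟨C, hC0, hC⟩ := L.toContinuousLinearMap.bound
  obtain ⟨y, hy⟩ := exists_fixedPoint_of_inner (f := fun y => C⁻¹ • L (f (L.symm (C • y))))
    (by fun_prop) (fun y => by
      rw [norm_smul, Real.norm_of_nonneg (by positivity), inv_mul_le_iff₀ hC0]
      exact (hC _).trans (mul_le_mul_of_nonneg_left (hf1 _) hC0.le))
  refine ⟨L.symm (C • y), ?_⟩
  rw [ContinuousLinearEquiv.eq_symm_apply]
  exact (inv_smul_eq_iff₀ hC0.ne').1 hy

/-- A continuous map on the closed unit ball without zeros takes some boundary point to a positive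
multiple of itself. -/
theorem exists_pos_smul_of_ne_zero {V : Type*} [NormedAddCommGroup V] [NormedSpace ℝ V]
    [FiniteDimensional ℝ V] {F : V → V} (hF : Continuous F) (h0 : ∀ x, F x ≠ 0) :
    ∃ (x : V) (c : ℝ), ‖x‖ = 1 ∧ 0 < c ∧ F x = c • x := by
  have hpos : ∀ x, 0 < ‖F x‖ := fun x => norm_pos_iff.2 (h0 x)
  have hn : ∀ x, ‖‖F x‖⁻¹ • F x‖ = 1 := fun x => by
    rw [norm_smul, norm_inv, norm_norm, inv_mul_cancel₀ (hpos x).ne']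
  obtain ⟨x, hx⟩ := exists_fixedPoint_of_norm_le_one (f := fun x => ‖F x‖⁻¹ • F x)
    ((hF.norm.inv₀ fun x => (hpos x).ne').smul hF) fun x => (hn x).le
  refine ⟨x, ‖F x‖, ?_, hpos x, ?_⟩
  · rw [← hn x, hx]
  · exact (inv_smul_eq_iff₀ (hpos x).ne').1 hx

end FixedPoint

/-! ### The pinched cube and its `n`-th homotopy group. -/

section PinchedCube

open scoped unitInterval

/-- A nonnegative function on the unit cube that vanishes on the boundary. -/
def bump {n : ℕ} (y : Fin n → ℝ) : ℝ := ∏ k, y k * (1 - y k)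

/-- A map of the unit cube to `ℝ × ℝⁿ` whose image is an `n`-sphere, namely the cube with its
boundary collapsed to the origin. -/
def pinch {n : ℕ} (y : Fin n → ℝ) : ℝ × (Fin n → ℝ) := (bump y, bump y • y)

/-- The real point of the cube given by a point of `I^n`. -/
def cubeVal {n : ℕ} (y : I^ (Fin n)) : Fin n → ℝ := fun k => y k

/-- The image of the unit cube under `pinch`, scaled by the factor `r`. -/
def pinchedCube (n : ℕ) (r : ℝ) : Set (ℝ × (Fin n → ℝ)) :=
  Set.range fun y : I^ (Fin n) => r • pinch (cubeVal y)

variable {n : ℕ}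

theorem continuous_cubeVal : Continuous (cubeVal (n := n)) := by
  unfold cubeVal
  fun_prop

theorem contDiff_pinch : ContDiff ℝ 1 (pinch (n := n)) := by
  have h : ContDiff ℝ 1 (bump (n := n)) := by
    unfold bump
    refine contDiff_prod fun k _ => ?_
    fun_prop
  unfold pinch
  fun_prop

theorem bump_nonneg (y : I^ (Fin n)) : 0 ≤ bump (cubeVal y) :=
  Finset.prod_nonneg fun k _ => mul_nonneg (y k).2.1 (sub_nonneg.2 (y k).2.2)

theorem pinch_eq_zero_of_mem_boundary {y : I^ (Fin n)} (hy : y ∈ Cube.boundary (Fin n)) :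
    pinch (cubeVal y) = 0 := by
  obtain ⟨k, hk⟩ := hy
  have : bump (cubeVal y) = 0 := by
    refine Finset.prod_eq_zero (Finset.mem_univ k) ?_
    rcases hk with hk | hk <;> simp [cubeVal, hk]
  simp [pinch, this]

theorem bump_half : bump (fun _ : Fin n => (1 / 2 : ℝ)) = (1 / 4) ^ n := by
  simp only [bump, Finset.prod_const, Finset.card_univ, Fintype.card_fin]
  norm_num

/-- The collapse map of the cube is not null-homotopic in its image. -/
theorem not_exists_nullhomotopy_pinch {h : I × (I^ (Fin n)) → ℝ × (Fin n → ℝ)}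
    (hc : Continuous h) (h0 : ∀ y, h (0, y) = pinch (cubeVal y)) (h1 : ∀ y, h (1, y) = 0)
    (hb : ∀ t, ∀ y ∈ Cube.boundary (Fin n), h (t, y) = 0)
    (hmem : ∀ p, ∃ y : I^ (Fin n), h p = pinch (cubeVal y)) : False := by
  let clamp : ℝ → I := fun s => Set.projIcc 0 1 zero_le_one ((s + 1) / 2)
  have hclamp : Continuous clamp := continuous_projIcc.comp (by fun_prop)
  have hcl : ∀ s : ℝ, |s| ≤ 1 → (clamp s : ℝ) = (s + 1) / 2 := fun s hs => by
    rw [abs_le] at hs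
    exact congrArg Subtype.val
      (Set.projIcc_of_mem zero_le_one ⟨by linarith, by linarith⟩ : clamp s = _)
  have hcl1 : clamp 1 = 1 := Subtype.ext (by rw [hcl 1 (by simp)]; norm_num)
  have hcl0 : clamp (-1) = 0 := Subtype.ext (by rw [hcl (-1) (by simp)]; norm_num)
  let Λ : ℝ × (Fin n → ℝ) → I × (I^ (Fin n)) := fun z => (clamp z.1, fun k => clamp (z.2 k))
  have hΛ : Continuous Λ := by fun_prop
  set c : ℝ := (1 / 4) ^ n / 2 with hcdef
  have hc0 : 0 < c := by positivity
  have hcenter : ∀ y : I^ (Fin n), bump (cubeVal y) • (1 - 2 * cubeVal y) = 0 →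
      0 < bump (cubeVal y) → bump (cubeVal y) = 2 * c := by
    intro y hy hpos
    have h2 : cubeVal y = fun _ => (1 / 2 : ℝ) := by
      have := (smul_eq_zero.1 hy).resolve_left hpos.ne'
      ext k
      have := congrFun this k
      simp at this
      linarith
    rw [h2, bump_half]
    ring
  -- The affine map `(a, w) ↦ (a - c, a - 2 w)` vanishes only at `(c, c / 2, …)`. This point is off
  -- the sphere: it would come from the centre of the cube, where `bump` is `2 * c`.
  let F : ℝ × (Fin n → ℝ) → ℝ × (Fin n → ℝ) := fun z =>
    ((h (Λ z)).1 - c, fun k => (h (Λ z)).1 - 2 * (h (Λ z)).2 k)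
  have hF : Continuous F := by fun_prop
  have hFφ : ∀ z y, h (Λ z) = pinch (cubeVal y) →
      F z = (bump (cubeVal y) - c, bump (cubeVal y) • (1 - 2 * cubeVal y)) := by
    intro z y hy
    simp only [F, hy, pinch]
    ext k
    · rfl
    · simp
      ring
  have hF0 : ∀ z, h (Λ z) = 0 → F z = (-c, 0) := by
    intro z hz
    simp only [F, hz]
    ext k <;> simp
  obtain ⟨⟨s, v⟩, l, hz, hl, hzl⟩ := exists_pos_smul_of_ne_zero hF (fun z hz => by
    obtain ⟨y, hy⟩ := hmem (Λ z)
    rw [hFφ z y hy, Prod.mk_eq_zero, sub_eq_zero] at hz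
    have := hcenter y hz.2 (by rw [hz.1]; exact hc0)
    linarith)
  rw [Prod.norm_mk] at hz
  have hs1 : |s| ≤ 1 := (le_max_left _ _).trans hz.le
  have hv1 : ‖v‖ ≤ 1 := (le_max_right _ _).trans hz.le
  rw [Prod.smul_mk] at hzl
  -- On the face `s = -1` the homotopy is the collapse map and `F z = (b - c, -b v)`, with `b` the
  -- value of `bump`; on all other faces it is `0` and `F z = (-c, 0)`. Neither is a positive
  -- multiple of `z`.
  by_cases hs : s = -1
  · subst hs
    have hφ : h (Λ (-1, v)) = pinch (cubeVal fun k => clamp (v k)) := by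
      simp only [Λ, hcl0]
      exact h0 _
    rw [hFφ _ _ hφ, Prod.mk.injEq] at hzl
    set y : I^ (Fin n) := fun k => clamp (v k)
    have hyv : 1 - 2 * cubeVal y = -v := by
      ext k
      have : ((clamp (v k) : I) : ℝ) = (v k + 1) / 2 := hcl _ ((norm_le_pi_norm v k).trans hv1)
      simp [cubeVal, y, this]
      ring
    have hv : v = 0 := by
      have h2 := hzl.2
      rw [hyv, smul_neg, neg_eq_iff_add_eq_zero, ← add_smul, smul_eq_zero] at h2
      have := bump_nonneg y
      exact h2.resolve_left (by positivity)
    have hy : cubeVal y = fun _ => (1 / 2 : ℝ) := by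
      ext k
      have := congrFun hyv k
      simp [hv] at this
      linarith
    have h3 := hzl.1
    rw [hy, bump_half] at h3
    simp only [smul_eq_mul] at h3
    have : (1 / 4 : ℝ) ^ n = 2 * c := by rw [hcdef]; ring
    linarith
  · have hzero : h (Λ (s, v)) = 0 ∧ (s = 1 ∨ v ≠ 0) := by
      rcases max_choice ‖s‖ ‖v‖ with hm | hm
      · rw [hm, Real.norm_eq_abs] at hz
        have : s = 1 := by
          rcases eq_or_eq_neg_of_abs_eq hz with h | h
          · exact h
          · exact absurd h hs
        refine ⟨?_, Or.inl this⟩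
        simp only [Λ, this, hcl1]
        exact h1 _
      · rw [hm] at hz
        have hne : v ≠ 0 := fun h => by simp [h] at hz
        refine ⟨hb _ _ ?_, Or.inr hne⟩
        obtain ⟨k, hk⟩ : ∃ k, |v k| = 1 := by
          by_contra! hcon
          have : ‖v‖ < 1 := (pi_norm_lt_iff one_pos).2 fun k =>
            lt_of_le_of_ne ((norm_le_pi_norm v k).trans hv1) (hcon k)
          linarith
        refine ⟨k, ?_⟩
        rcases eq_or_eq_neg_of_abs_eq hk with h | h
        · right; simp only [h, hcl1]
        · left; simp only [h, hcl0]
    rw [hF0 _ hzero.1, Prod.mk.injEq] at hzl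
    rcases hzero.2 with h2 | h2
    · have := hzl.1
      rw [h2, smul_eq_mul] at this
      linarith
    · exact h2 ((smul_eq_zero.1 hzl.2.symm).resolve_left hl.ne')

theorem isCompact_pinchedCube (r : ℝ) : IsCompact (pinchedCube n r) :=
  isCompact_range ((contDiff_pinch.continuous.comp continuous_cubeVal).const_smul r)

theorem smul_pinch_mem_pinchedCube (r : ℝ) (y : I^ (Fin n)) :
    r • pinch (cubeVal y) ∈ pinchedCube n r := ⟨y, rfl⟩

instance subsingleton_pinchedCube_zero : Subsingleton (pinchedCube n 0) := by
  refine ⟨fun ⟨x, y, hx⟩ ⟨x', y', hx'⟩ => Subtype.ext ?_⟩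
  simp only [zero_smul] at hx hx'
  exact hx.symm.trans hx'

/-- The scaled pinched cube has a nontrivial `n`-th homotopy group unless the scale vanishes. -/
theorem not_subsingleton_pi_pinchedCube {r : ℝ} (hr : r ≠ 0) (x : pinchedCube n r)
    (hx : (x : ℝ × (Fin n → ℝ)) = 0) : ¬ Subsingleton (π_ n (pinchedCube n r) x) := by
  intro hsub
  let γ : GenLoop (Fin n) (pinchedCube n r) x :=
    ⟨⟨fun y => ⟨r • pinch (cubeVal y), smul_pinch_mem_pinchedCube r y⟩,
      ((contDiff_pinch.continuous.comp continuous_cubeVal).const_smul r).subtype_mk _⟩,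
      fun y hy => Subtype.ext (by
        simp only [ContinuousMap.coe_mk]
        rw [pinch_eq_zero_of_mem_boundary hy, smul_zero, hx])⟩
  have heq : (⟦γ⟧ : HomotopyGroup (Fin n) (pinchedCube n r) x) = ⟦GenLoop.const⟧ :=
    hsub.elim _ _
  obtain ⟨H⟩ : GenLoop.Homotopic γ GenLoop.const := Quotient.exact heq
  refine not_exists_nullhomotopy_pinch (n := n)
    (h := fun p => r⁻¹ • ((H p : pinchedCube n r) : ℝ × (Fin n → ℝ))) ?_ ?_ ?_ ?_ ?_
  · exact (continuous_subtype_val.comp H.continuous).const_smul r⁻¹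
  · intro y
    rw [H.apply_zero]
    exact inv_smul_smul₀ hr _
  · intro y
    rw [H.apply_one]
    change r⁻¹ • (x : ℝ × (Fin n → ℝ)) = 0
    rw [hx, smul_zero]
  · intro t y hy
    rw [H.eq_fst t hy]
    change r⁻¹ • (r • pinch (cubeVal y)) = 0
    rw [pinch_eq_zero_of_mem_boundary hy, smul_zero, smul_zero]
  · intro p
    obtain ⟨y, hy⟩ := (H p : pinchedCube n r).2
    exact ⟨y, by rw [← hy]; exact inv_smul_smul₀ hr _⟩

theorem subsingleton_pi_of_subsingleton {X : Type*} [TopologicalSpace X] [Subsingleton X] (x : X) :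
    Subsingleton (π_ n X x) := by
  refine ⟨fun a b => ?_⟩
  induction a using Quotient.inductionOn with | _ a => ?_
  induction b using Quotient.inductionOn with | _ b => ?_
  exact congrArg _ (GenLoop.ext _ _ fun y => Subsingleton.elim _ _)

end PinchedCube

/-! ### Primitive recursive bookkeeping. -/

section Primrec

variable {α ι : Type*} [Primcodable α]

theorem primrec_finset_prod (s : Finset ι) {f : ι → α → ℕ} (hf : ∀ i, Primrec (f i)) :
    Primrec fun a => ∏ i ∈ s, f i a := by
  classical
  induction s using Finset.induction_on with
  | empty => simpa using Primrec.const 1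
  | insert i s hi ih =>
    simp only [Finset.prod_insert hi]
    exact Primrec.nat_mul.comp (hf i) ih

theorem primrec_finset_sup (s : Finset ι) {f : ι → α → ℕ} (hf : ∀ i, Primrec (f i)) :
    Primrec fun a => s.sup fun i => f i a := by
  classical
  induction s using Finset.induction_on with
  | empty => simpa using Primrec.const 0
  | insert i s hi ih =>
    simp only [Finset.sup_insert]
    exact Primrec.nat_max.comp (hf i) ih

theorem primrec_nat_pow_const (m : ℕ) {f : α → ℕ} (hf : Primrec f) : Primrec fun a => f a ^ m := by
  simpa using primrec_finset_prod (Finset.range m) fun _ => hf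

/-- The distance between two natural numbers. -/
def absDiff (a b : ℕ) : ℕ := (a - b) + (b - a)

theorem primrec_absDiff : Primrec₂ absDiff :=
  Primrec.nat_add.comp Primrec.nat_sub (Primrec.nat_sub.comp Primrec.snd Primrec.fst)

theorem cast_absDiff (a b : ℕ) : (absDiff a b : ℝ) = |(a : ℝ) - b| := by
  rcases le_total a b with h | h
  · rw [absDiff, Nat.sub_eq_zero_of_le h, zero_add, Nat.cast_sub h, abs_sub_comm,
      abs_of_nonneg (sub_nonneg.2 (by exact_mod_cast h))]
  · rw [absDiff, Nat.sub_eq_zero_of_le h, add_zero, Nat.cast_sub h,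
      abs_of_nonneg (sub_nonneg.2 (by exact_mod_cast h))]

/-- All lists of length `n` with entries less than `m`. -/
def listsBelow (m : ℕ) : ℕ → List (List ℕ)
  | 0 => [[]]
  | n + 1 => (listsBelow m n).flatMap fun l => (List.range m).map fun c => c :: l

theorem primrec_listsBelow (n : ℕ) : Primrec fun m => listsBelow m n := by
  induction n with
  | zero => exact Primrec.const _
  | succ n ih =>
    refine Primrec.list_flatMap ih (Primrec.list_map (Primrec.list_range.comp Primrec.fst) ?_)
    exact Primrec.list_cons.comp Primrec.snd (Primrec.snd.comp Primrec.fst)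

theorem ofFn_mem_listsBelow {m n : ℕ} (c : Fin n → ℕ) (hc : ∀ k, c k < m) :
    List.ofFn c ∈ listsBelow m n := by
  induction n with
  | zero => simp [listsBelow]
  | succ n ih =>
    rw [List.ofFn_succ, listsBelow, List.mem_flatMap]
    exact ⟨_, ih (fun k => c k.succ) fun k => hc _,
      List.mem_map.2 ⟨c 0, List.mem_range.2 (hc 0), rfl⟩⟩

end Primrec

/-! ### Rational points of the pinched cube and their distances. -/

section Grid

open scoped unitInterval

variable {n : ℕ}

/-- The denominator of the coordinates of the grid point named `i`. -/
def gridDen (i : ℕ) : ℕ := (Denumerable.ofNat (ℕ × List ℕ) i).1 + 1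

/-- The numerator of the `k`-th coordinate of the grid point named `i`. -/
def gridNum (k i : ℕ) : ℕ := min ((Denumerable.ofNat (ℕ × List ℕ) i).2.getD k 0) (gridDen i)

/-- The rational point of the unit cube named `i`. -/
noncomputable def gridPoint (n i : ℕ) : I^ (Fin n) := fun k =>
  ⟨(gridNum k i : ℝ) / gridDen i, by positivity,
    div_le_one_of_le₀ (by exact_mod_cast min_le_right _ _) (by positivity)⟩

/-- The numerator of `bump` at the grid point named `i`. -/
def bumpNum (n i : ℕ) : ℕ := ∏ k : Fin n, gridNum k i * (gridDen i - gridNum k i)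

/-- The denominator of the coordinates of `pinch` at the grid point named `i`. -/
def pinchDen (n i : ℕ) : ℕ := gridDen i ^ (2 * n + 1)

/-- The numerator of the distance of `pinch` at the grid points named `i` and `j`. -/
def distNum (n i j : ℕ) : ℕ :=
  max (absDiff (bumpNum n i * gridDen i * pinchDen n j) (bumpNum n j * gridDen j * pinchDen n i))
    (Finset.univ.sup fun k : Fin n =>
      absDiff (bumpNum n i * gridNum k i * pinchDen n j) (bumpNum n j * gridNum k j * pinchDen n i))

theorem primrec_gridDen : Primrec gridDen :=
  Primrec.succ.comp (Primrec.fst.comp (Primrec.ofNat _))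

theorem primrec_gridNum (k : ℕ) : Primrec (gridNum k) :=
  Primrec.nat_min.comp ((Primrec.list_getD 0).comp (Primrec.snd.comp (Primrec.ofNat _))
    (Primrec.const k)) primrec_gridDen

theorem primrec_bumpNum : Primrec (bumpNum n) :=
  primrec_finset_prod _ fun k => Primrec.nat_mul.comp (primrec_gridNum k)
    (Primrec.nat_sub.comp primrec_gridDen (primrec_gridNum k))

theorem primrec_pinchDen : Primrec (pinchDen n) := primrec_nat_pow_const _ primrec_gridDen

theorem primrec_distNum : Primrec₂ (distNum n) := by
  have h : ∀ {u : ℕ → ℕ}, Primrec u → Primrec fun p : ℕ × ℕ =>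
      absDiff (bumpNum n p.1 * u p.1 * pinchDen n p.2) (bumpNum n p.2 * u p.2 * pinchDen n p.1) := by
    intro u hu
    have h1 : Primrec fun i => bumpNum n i * u i := Primrec.nat_mul.comp primrec_bumpNum hu
    exact primrec_absDiff.comp
      (Primrec.nat_mul.comp (h1.comp Primrec.fst) (primrec_pinchDen.comp Primrec.snd))
      (Primrec.nat_mul.comp (h1.comp Primrec.snd) (primrec_pinchDen.comp Primrec.fst))
  exact Primrec.nat_max.comp (h primrec_gridDen)
    (primrec_finset_sup _ fun k => h (primrec_gridNum k))

theorem gridNum_le (k i : ℕ) : gridNum k i ≤ gridDen i := min_le_right _ _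

theorem gridDen_pos (i : ℕ) : 0 < gridDen i := Nat.succ_pos _

theorem pinchDen_pos (i : ℕ) : 0 < pinchDen n i := pow_pos (gridDen_pos i) _

theorem bump_gridPoint (i : ℕ) :
    bump (cubeVal (gridPoint n i)) = bumpNum n i / (gridDen i : ℝ) ^ (2 * n) := by
  have hD : (gridDen i : ℝ) ≠ 0 := by exact_mod_cast (gridDen_pos i).ne'
  have hk : ∀ k : Fin n, (gridNum k i : ℝ) / gridDen i * (1 - gridNum k i / gridDen i) =
      (gridNum k i * (gridDen i - gridNum k i) : ℕ) / (gridDen i : ℝ) ^ 2 := fun k => by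
    rw [Nat.cast_mul, Nat.cast_sub (gridNum_le _ _)]
    field_simp
  simp only [bump, cubeVal, gridPoint, hk, Finset.prod_div_distrib, Finset.prod_const,
    Finset.card_univ, Fintype.card_fin, bumpNum, Nat.cast_prod, ← pow_mul]

theorem pinch_gridPoint (i : ℕ) :
    pinch (cubeVal (gridPoint n i)) = (((bumpNum n i * gridDen i : ℕ) : ℝ) / pinchDen n i,
      fun k : Fin n => ((bumpNum n i * gridNum k i : ℕ) : ℝ) / pinchDen n i) := by
  have hD : (gridDen i : ℝ) ≠ 0 := by exact_mod_cast (gridDen_pos i).ne'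
  simp only [pinch, bump_gridPoint, pinchDen]
  ext k
  · push_cast
    field_simp
    ring
  · simp only [cubeVal, gridPoint, Pi.smul_apply, smul_eq_mul]
    push_cast
    field_simp
    ring

theorem norm_eq_sup_div {ι : Type*} [Fintype ι] {v : ι → ℝ} {w : ι → ℕ} {D : ℝ} (hD : 0 < D)
    (h : ∀ k, |v k| = w k / D) : ‖v‖ = (Finset.univ.sup w : ℕ) / D := by
  refine le_antisymm ((pi_norm_le_iff_of_nonneg (by positivity)).2 fun k => ?_) ?_
  · rw [Real.norm_eq_abs, h]
    gcongr
    exact Finset.le_sup (Finset.mem_univ k)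
  · rw [div_le_iff₀ hD]
    refine (Nat.le_floor_iff (by positivity)).1 (Finset.sup_le fun k _ => Nat.le_floor ?_)
    have := norm_le_pi_norm v k
    rwa [Real.norm_eq_abs, h, div_le_iff₀ hD] at this

/-- In the sup metric these distances are exact rationals, so only the scale will need
approximation. -/
theorem dist_pinch_gridPoint (i j : ℕ) :
    dist (pinch (cubeVal (gridPoint n i))) (pinch (cubeVal (gridPoint n j))) =
      distNum n i j / (pinchDen n i * pinchDen n j : ℕ) := by
  have h1 : (0 : ℝ) < pinchDen n i := by exact_mod_cast pinchDen_pos i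
  have h2 : (0 : ℝ) < pinchDen n j := by exact_mod_cast pinchDen_pos j
  have key : ∀ a b : ℕ, |(a : ℝ) / pinchDen n i - b / pinchDen n j| =
      absDiff (a * pinchDen n j) (b * pinchDen n i) / (pinchDen n i * pinchDen n j : ℕ) := by
    intro a b
    have : (a : ℝ) / pinchDen n i - b / pinchDen n j =
        (a * pinchDen n j - b * pinchDen n i) / (pinchDen n i * pinchDen n j) := by
      field_simp
    rw [this, abs_div, cast_absDiff, abs_of_pos (mul_pos h1 h2)]
    push_cast
    rfl
  have hD : (0 : ℝ) < (pinchDen n i * pinchDen n j : ℕ) := by push_cast; positivity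
  rw [dist_eq_norm, pinch_gridPoint, pinch_gridPoint, Prod.mk_sub_mk, Prod.norm_mk,
    Real.norm_eq_abs, key, Pi.sub_def, norm_eq_sup_div hD fun k => key _ _, distNum, Nat.cast_max,
    max_div_div_right hD.le]

theorem bump_le_one (y : I^ (Fin n)) : bump (cubeVal y) ≤ 1 :=
  Finset.prod_le_one (fun k _ => mul_nonneg (y k).2.1 (sub_nonneg.2 (y k).2.2)) fun k _ => by
    have h1 := (y k).2.1
    have h2 := (y k).2.2
    simp only [cubeVal]
    nlinarith

theorem dist_pinch_le_one (x y : I^ (Fin n)) : dist (pinch (cubeVal x)) (pinch (cubeVal y)) ≤ 1 := by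
  have key : ∀ a b : ℝ, 0 ≤ a → a ≤ 1 → 0 ≤ b → b ≤ 1 → dist a b ≤ 1 := by
    intro a b _ _ _ _
    rw [Real.dist_eq, abs_le]
    constructor <;> linarith
  rw [Prod.dist_eq, max_le_iff, dist_pi_le_iff zero_le_one]
  refine ⟨key _ _ (bump_nonneg x) (bump_le_one x) (bump_nonneg y) (bump_le_one y), fun k => ?_⟩
  exact key _ _ (mul_nonneg (bump_nonneg x) (x k).2.1)
    (mul_le_one₀ (bump_le_one x) (x k).2.1 (x k).2.2) (mul_nonneg (bump_nonneg y) (y k).2.1)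
    (mul_le_one₀ (bump_le_one y) (y k).2.1 (y k).2.2)

theorem exists_lipschitz_pinch (n : ℕ) : ∃ K : ℕ, ∀ x y : I^ (Fin n),
    dist (pinch (cubeVal x)) (pinch (cubeVal y)) ≤ K * dist (cubeVal x) (cubeVal y) := by
  obtain ⟨K, hK⟩ := (contDiff_pinch (n := n)).contDiffOn.exists_lipschitzOnWith one_ne_zero
    (convex_Icc 0 1) (isCompact_Icc (a := (0 : Fin n → ℝ)) (b := 1))
  obtain ⟨m, hm⟩ := exists_nat_ge (K : ℝ)
  have hmem : ∀ x : I^ (Fin n), cubeVal x ∈ Set.Icc (0 : Fin n → ℝ) 1 := fun x =>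
    ⟨fun k => (x k).2.1, fun k => (x k).2.2⟩
  exact ⟨m, fun x y => (hK.dist_le_mul _ (hmem x) _ (hmem y)).trans
    (mul_le_mul_of_nonneg_right hm dist_nonneg)⟩

/-- The names of the points of a grid with mesh `1 / (N + 1)`. -/
def gridNames (n N : ℕ) : List ℕ := (listsBelow (N + 2) n).map fun l => encode (N, l)

theorem primrec_gridNames : Primrec (gridNames n) :=
  Primrec.list_map ((primrec_listsBelow n).comp (Primrec.succ.comp Primrec.succ))
    (Primrec.encode.comp (Primrec.pair Primrec.fst Primrec.snd))

theorem exists_mem_gridNames (N : ℕ) (y : I^ (Fin n)) :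
    ∃ i ∈ gridNames n N, dist (cubeVal y) (cubeVal (gridPoint n i)) ≤ 1 / (N + 1) := by
  have hN : (0 : ℝ) < N + 1 := by positivity
  let c : Fin n → ℕ := fun k => ⌊(y k : ℝ) * (N + 1)⌋₊
  have hc : ∀ k, c k ≤ N + 1 := fun k => by
    refine Nat.floor_le_of_le ?_
    have := (y k).2.2
    push_cast
    nlinarith
  refine ⟨encode (N, List.ofFn c), List.mem_map.2 ⟨_, ofFn_mem_listsBelow c fun k =>
    Nat.lt_succ_of_le (hc k), rfl⟩, (dist_pi_le_iff (by positivity)).2 fun k => ?_⟩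
  have h1 : gridDen (encode (N, List.ofFn c)) = N + 1 := by
    simp [gridDen]
  have h2 : gridNum k (encode (N, List.ofFn c)) = c k := by
    rw [gridNum, h1]
    simp [hc k]
  simp only [cubeVal, gridPoint, h1, h2]
  have h3 : (c k : ℝ) ≤ (y k : ℝ) * (N + 1) := Nat.floor_le (mul_nonneg (y k).2.1 hN.le)
  have h4 : (y k : ℝ) * (N + 1) < c k + 1 := Nat.lt_floor_add_one _
  rw [Real.dist_eq, abs_le]
  push_cast
  constructor
  · have : (c k : ℝ) / (N + 1) ≤ y k := (div_le_iff₀ hN).2 h3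
    have : 0 ≤ 1 / ((N : ℝ) + 1) := by positivity
    linarith
  · rw [sub_le_iff_le_add, ← add_div, le_div_iff₀ hN]
    linarith

end Grid

/-! ### Halting times as computable real numbers. -/

section Halting

/-- The program `e`, run for `k` steps on the input `0`, halts. -/
def haltsBy (e : Code) (k : ℕ) : Bool := (Code.evaln k e 0).isSome

/-- The halting time of the program `e`, cut off at `N`. -/
def haltTime (e : Code) : ℕ → ℕ
  | 0 => 0
  | N + 1 => bif haltsBy e (haltTime e N) then haltTime e N else haltTime e N + 1

theorem primrec_haltTime : Primrec₂ haltTime := by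
  have hh : Primrec₂ haltsBy := Primrec.option_isSome.comp (Code.primrec_evaln.comp
    (Primrec.pair (Primrec.pair Primrec.snd Primrec.fst) (Primrec.const 0)))
  have h := Primrec.nat_rec (f := fun _ : Code => 0)
    (g := fun (e : Code) (p : ℕ × ℕ) => bif haltsBy e p.2 then p.2 else p.2 + 1)
    (Primrec.const 0) (Primrec.cond (hh.comp Primrec.fst (Primrec.snd.comp Primrec.snd))
      (Primrec.snd.comp Primrec.snd) (Primrec.succ.comp (Primrec.snd.comp Primrec.snd)))
  refine h.of_eq fun e N => ?_
  induction N with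
  | zero => rfl
  | succ N ih => simp only [haltTime, ← ih]

theorem haltTime_spec (e : Code) (N : ℕ) :
    (∀ k < haltTime e N, haltsBy e k = false) ∧
      (haltsBy e (haltTime e N) = true ∨ haltTime e N = N) := by
  induction N with
  | zero => exact ⟨fun k hk => absurd hk (Nat.not_lt_zero k), Or.inr rfl⟩
  | succ N ih =>
    cases h : haltsBy e (haltTime e N) with
    | true => simpa [haltTime, h] using ih.1
    | false =>
      simp only [haltTime, h, cond_false]
      refine ⟨fun k hk => ?_, ?_⟩
      · rcases Nat.lt_succ_iff_lt_or_eq.1 hk with hk | rfl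
        · exact ih.1 k hk
        · exact h
      · right
        rw [ih.2.resolve_left (by simp [h])]

theorem exists_haltsBy_iff (e : Code) : (∃ k, haltsBy e k = true) ↔ (e.eval 0).Dom := by
  simp only [haltsBy, Option.isSome_iff_exists, Part.dom_iff_mem, Code.evaln_complete, Option.mem_def]
  exact exists_comm

open Classical in
/-- The number `1 / (t + 1)` if the program `e` halts after `t` steps, and `0` if it never halts. -/
noncomputable def haltScale (e : Code) : ℝ :=
  if h : ∃ k, haltsBy e k = true then 1 / ((Nat.find h : ℝ) + 1) else 0

theorem haltScale_eq_zero_iff (e : Code) : haltScale e = 0 ↔ ¬ (e.eval 0).Dom := by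
  classical
  rw [← exists_haltsBy_iff, haltScale]
  split_ifs with h
  · simp only [h, not_true, iff_false]
    positivity
  · simp [h]

/-- Either the halting step has been found and the scale is exact, or both numbers lie in `[0, 1 /
(N + 1)]`. -/
theorem abs_haltTime_sub_haltScale_le (e : Code) (N : ℕ) :
    |1 / ((haltTime e N : ℝ) + 1) - haltScale e| ≤ 1 / ((N : ℝ) + 1) := by
  classical
  obtain ⟨h1, h2⟩ := haltTime_spec e N
  by_cases hh : haltsBy e (haltTime e N) = true
  · have hex : ∃ k, haltsBy e k = true := ⟨_, hh⟩
    have : Nat.find hex = haltTime e N := by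
      refine (Nat.find_eq_iff hex).2 ⟨hh, fun k hk => by simp [h1 k hk]⟩
    rw [haltScale, dif_pos hex, this, sub_self, abs_zero]
    positivity
  · have hN := h2.resolve_left hh
    rw [hN] at h1 ⊢
    have hpos : (0 : ℝ) < 1 / ((N : ℝ) + 1) := by positivity
    rw [haltScale]
    split_ifs with hex
    · have hle : N ≤ Nat.find hex := by
        by_contra hlt
        have := Nat.find_spec hex
        rw [h1 _ (not_le.1 hlt)] at this
        exact Bool.noConfusion this
      have h3 : 1 / ((Nat.find hex : ℝ) + 1) ≤ 1 / ((N : ℝ) + 1) := by gcongr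
      have h4 : (0 : ℝ) < 1 / ((Nat.find hex : ℝ) + 1) := by positivity
      rw [abs_of_nonneg (sub_nonneg.2 h3)]
      linarith
    · rw [sub_zero, abs_of_pos hpos]

theorem haltScale_nonneg (e : Code) : 0 ≤ haltScale e := by
  rw [haltScale]
  split_ifs <;> positivity

theorem haltScale_le_one (e : Code) : haltScale e ≤ 1 := by
  rw [haltScale]
  split_ifs
  · exact div_le_one_of_le₀ (by linarith [Nat.cast_nonneg (α := ℝ) (Nat.find ‹_›)]) (by positivity)
  · exact zero_le_one

/-- Deciding the halting problem on input `0`, even negatively, is impossible. -/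
theorem not_decides_halting {f : Code →. Bool} (hf : Partrec f)
    (h : ∀ e, ∃ b ∈ f e, (b = true ↔ ¬ (e.eval 0).Dom)) : False := by
  choose g hg1 hg2 using h
  have hg : Computable g := hf.of_eq_tot hg1
  refine ComputablePred.halting_problem 0 (ComputablePred.computable_iff.2
    ⟨fun e => !g e, Primrec.not.to_comp.comp hg, ?_⟩)
  ext e
  have := hg2 e
  cases hb : g e <;> simp_all

end Halting

/-! ### Presentations computed from programs. -/

section Presentation

open scoped unitInterval

/-- The points of the scaled pinched cube that are the images of the grid points. -/
noncomputable def pinchedPoint (n : ℕ) (r : ℝ) (i : ℕ) : pinchedCube n r :=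
  ⟨r • pinch (cubeVal (gridPoint n i)), smul_pinch_mem_pinchedCube r _⟩

/-- Distances in the pinched cube scaled by the halting time of a program, cut off at the precision
required. -/
def approxDist (n : ℕ) (e : Code) (x : (ℕ × ℕ) × ℕ × ℕ) : ℕ × ℕ :=
  (distNum n x.1.1 x.1.2, pinchDen n x.1.1 * pinchDen n x.1.2 * (haltTime e x.2.2 + 1) - 1)

theorem primrec_approxDist (n : ℕ) : Primrec₂ (approxDist n) := by
  have hi : Primrec fun p : Code × (ℕ × ℕ) × ℕ × ℕ => p.2.1.1 :=
    Primrec.fst.comp (Primrec.fst.comp Primrec.snd)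
  have hj : Primrec fun p : Code × (ℕ × ℕ) × ℕ × ℕ => p.2.1.2 :=
    Primrec.snd.comp (Primrec.fst.comp Primrec.snd)
  have hq : Primrec fun p : Code × (ℕ × ℕ) × ℕ × ℕ => p.2.2.2 :=
    Primrec.snd.comp (Primrec.snd.comp Primrec.snd)
  exact Primrec.pair (primrec_distNum.comp hi hj) (Primrec.nat_sub.comp (Primrec.nat_mul.comp
    (Primrec.nat_mul.comp (primrec_pinchDen.comp hi) (primrec_pinchDen.comp hj))
    (Primrec.succ.comp (primrec_haltTime.comp Primrec.fst hq))) (Primrec.const 1))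

theorem one_div_le_posRatOf (x : ℕ × ℕ) : 1 / ((x.2 : ℝ) + 1) ≤ posRatOf x := by
  unfold posRatOf
  gcongr
  linarith [Nat.cast_nonneg (α := ℝ) x.1]

/-- Unscaled distances are at most `1`, so the error is at most that of the scale, and cutting off
at the denominator index `x.2` suffices. -/
theorem abs_ratOf_approxDist_sub_le (n : ℕ) (e : Code) (i j : ℕ) (x : ℕ × ℕ) :
    |ratOf (approxDist n e ((i, j), x)) -
      dist (pinchedPoint n (haltScale e) i) (pinchedPoint n (haltScale e) j)| ≤ posRatOf x := by
  set y := pinch (cubeVal (gridPoint n i))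
  set z := pinch (cubeVal (gridPoint n j))
  have h1 : ratOf (approxDist n e ((i, j), x)) = 1 / ((haltTime e x.2 : ℝ) + 1) * dist y z := by
    rw [dist_pinch_gridPoint, ratOf, approxDist]
    have hpos : 1 ≤ pinchDen n i * pinchDen n j * (haltTime e x.2 + 1) :=
      Nat.mul_pos (Nat.mul_pos (pinchDen_pos i) (pinchDen_pos j)) (Nat.succ_pos _)
    have hi : (pinchDen n i : ℝ) ≠ 0 := by exact_mod_cast (pinchDen_pos i).ne'
    have hj : (pinchDen n j : ℝ) ≠ 0 := by exact_mod_cast (pinchDen_pos j).ne'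
    have ht : (haltTime e x.2 : ℝ) + 1 ≠ 0 := by positivity
    simp only [Nat.cast_sub hpos]
    push_cast
    field_simp
    ring
  have h2 : dist (pinchedPoint n (haltScale e) i) (pinchedPoint n (haltScale e) j) =
      haltScale e * dist y z := by
    rw [Subtype.dist_eq]
    change dist (haltScale e • y) (haltScale e • z) = _
    rw [dist_smul₀, Real.norm_of_nonneg (haltScale_nonneg e)]
  rw [h1, h2, ← sub_mul, abs_mul, abs_of_nonneg (dist_nonneg (x := y))]
  calc _ ≤ 1 / ((x.2 : ℝ) + 1) * 1 := mul_le_mul (abs_haltTime_sub_haltScale_le e x.2)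
        (dist_pinch_le_one _ _) dist_nonneg (by positivity)
    _ ≤ _ := by rw [mul_one]; exact one_div_le_posRatOf x

/-- Scales are at most `1`, so a single net program serves every `e`. The strict bound is `K / (K (q
+ 1) + 1) < 1 / (q + 1)`, where `q = x.2`. -/
theorem isNet_gridNames {n K : ℕ} (hK : ∀ x y : I^ (Fin n),
    dist (pinch (cubeVal x)) (pinch (cubeVal y)) ≤ K * dist (cubeVal x) (cubeVal y))
    {r : ℝ} (hr0 : 0 ≤ r) (hr1 : r ≤ 1) (x : ℕ × ℕ) :
    IsNet (pinchedPoint n r) (gridNames n (K * (x.2 + 1))) (posRatOf x) := by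
  rintro ⟨_, y, rfl⟩
  obtain ⟨i, hi, hd⟩ := exists_mem_gridNames (K * (x.2 + 1)) y
  refine ⟨i, hi, lt_of_lt_of_le ?_ (one_div_le_posRatOf x)⟩
  rw [Subtype.dist_eq]
  change dist (r • pinch (cubeVal y)) (r • pinch (cubeVal (gridPoint n i))) < _
  rw [dist_smul₀, Real.norm_of_nonneg hr0]
  have h1 : dist (pinch (cubeVal y)) (pinch (cubeVal (gridPoint n i))) ≤
      K * (1 / ((K * (x.2 + 1) : ℕ) + 1)) :=
    (hK _ _).trans (mul_le_mul_of_nonneg_left hd (Nat.cast_nonneg K))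
  calc _ ≤ 1 * dist (pinch (cubeVal y)) (pinch (cubeVal (gridPoint n i))) :=
        mul_le_mul_of_nonneg_right hr1 dist_nonneg
    _ ≤ K * (1 / ((K * (x.2 + 1) : ℕ) + 1)) := by rwa [one_mul]
    _ < _ := by
      push_cast
      rw [mul_one_div, div_lt_div_iff₀ (by positivity) (by positivity)]
      linarith

/-- There is a computable assignment of presentations to programs, presenting the pinched cube scaled
by the halting time of the program. -/
theorem exists_computable_presentation (n : ℕ) : ∃ T : Code → Code × Code, Computable T ∧
    ∀ e, Presents (T e) (pinchedPoint n (haltScale e)) := by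
  obtain ⟨K, hK⟩ := exists_lipschitz_pinch n
  -- One program handles all `e`; currying (the s-m-n theorem) makes the distance program a
  -- computable function of `e`.
  obtain ⟨c, hc⟩ : ∃ c : Code, ∀ e x, (c.curry (encode e)).eval (encode x) =
      Part.some (encode (approxDist n e x)) := by
    have hp : Primrec fun m : ℕ => encode (approxDist n (Denumerable.ofNat Code m.unpair.1)
        (Denumerable.ofNat ((ℕ × ℕ) × ℕ × ℕ) m.unpair.2)) :=
      Primrec.encode.comp ((primrec_approxDist n).comp
        ((Primrec.ofNat _).comp (Primrec.fst.comp Primrec.unpair))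
        ((Primrec.ofNat _).comp (Primrec.snd.comp Primrec.unpair)))
    obtain ⟨c, hc⟩ := Code.exists_code.1 (Nat.Partrec.of_primrec (Primrec.nat_iff.1 hp))
    refine ⟨c, fun e x => ?_⟩
    rw [Code.eval_curry, hc, PFun.coe_val, Nat.unpair_pair, Denumerable.ofNat_encode,
      Denumerable.ofNat_encode]
  obtain ⟨c', hc'⟩ : ∃ c' : Code, ∀ x : ℕ × ℕ, c'.eval (encode x) =
      Part.some (encode (gridNames n (K * (x.2 + 1)))) := by
    have hp : Primrec fun m : ℕ => encode (gridNames n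
        (K * ((Denumerable.ofNat (ℕ × ℕ) m).2 + 1))) :=
      Primrec.encode.comp (primrec_gridNames.comp (Primrec.nat_mul.comp (Primrec.const K)
        (Primrec.succ.comp (Primrec.snd.comp (Primrec.ofNat _)))))
    obtain ⟨c', hc'⟩ := Code.exists_code.1 (Nat.Partrec.of_primrec (Primrec.nat_iff.1 hp))
    refine ⟨c', fun x => ?_⟩
    rw [hc', PFun.coe_val, Denumerable.ofNat_encode]
  refine ⟨fun e => (c.curry (encode e), c'), Primrec.to_comp (Primrec.pair
    (Code.primrec₂_curry.comp (Primrec.const c) Primrec.encode) (Primrec.const c')),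
    fun e => ⟨fun i j x => ⟨_, ?_, abs_ratOf_approxDist_sub_le n e i j x⟩, fun x =>
      ⟨_, ?_, isNet_gridNames hK (haltScale_nonneg e) (haltScale_le_one e) x⟩⟩⟩
  · simp only [hc, Part.mem_some_iff]
  · simp only [hc', Part.mem_some_iff]

/-- This name gives the corner `0` of the cube, a boundary point only when `n ≥ 1`, as the boundary
of the `0`-cube is empty. -/
theorem pinchedPoint_origin {n : ℕ} (hn : 1 ≤ n) (r : ℝ) :
    (pinchedPoint n r (encode ((0, []) : ℕ × List ℕ)) : ℝ × (Fin n → ℝ)) = 0 := by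
  have : gridPoint n (encode ((0, []) : ℕ × List ℕ)) ∈ Cube.boundary (Fin n) :=
    ⟨⟨0, hn⟩, Or.inl (Subtype.ext (by simp [gridPoint, gridNum]))⟩
  change r • pinch (cubeVal (gridPoint n _)) = 0
  rw [pinch_eq_zero_of_mem_boundary this, smul_zero]

theorem subsingleton_pi_pinchedCube_haltScale {n : ℕ} {e : Code} (he : ¬ (e.eval 0).Dom)
    (x : pinchedCube n (haltScale e)) : Subsingleton (π_ n (pinchedCube n (haltScale e)) x) := by
  have : Subsingleton (pinchedCube n (haltScale e)) := by
    rw [(haltScale_eq_zero_iff e).2 he]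
    infer_instance
  exact subsingleton_pi_of_subsingleton x

end Presentation

/-- For every order `n ≥ 1` there is no algorithm that decides whether `π_n` of an arbitrary
constructive compact space is trivial, neither for the space alone (at all base points) nor for
the space with a given base point. -/
theorem corollary1 (n : ℕ) (hn : 1 ≤ n) :
    (¬ ∃ Q : Code × Code →. Bool, Partrec Q ∧ DecidesTrivialPi n Q) ∧
    (¬ ∃ Q : (Code × Code) × ℕ →. Bool, Partrec Q ∧ DecidesTrivialPiAt n Q) := by
  obtain ⟨T, hT, hTp⟩ := exists_computable_presentation n
  have hcompact : ∀ e, CompactSpace (pinchedCube n (haltScale e)) := fun e =>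
    isCompact_iff_compactSpace.1 (isCompact_pinchedCube _)
  have hat : ∀ e, Subsingleton (π_ n (pinchedCube n (haltScale e))
      (pinchedPoint n (haltScale e) (encode ((0, []) : ℕ × List ℕ)))) → ¬ (e.eval 0).Dom := by
    intro e h
    by_contra hdom
    exact not_subsingleton_pi_pinchedCube (fun h0 => (haltScale_eq_zero_iff e).1 h0 hdom) _
      (pinchedPoint_origin hn _) h
  constructor
  · rintro ⟨Q, hQ, hdec⟩
    refine not_decides_halting (hQ.comp hT) fun e => ?_
    obtain ⟨b, hb, hiff⟩ := hdec (T e) _ _ (hTp e)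
    exact ⟨b, hb, hiff.trans ⟨fun h => hat e (h _), subsingleton_pi_pinchedCube_haltScale⟩⟩
  · rintro ⟨Q, hQ, hdec⟩
    refine not_decides_halting
      (hQ.comp (hT.pair (Computable.const (encode ((0, []) : ℕ × List ℕ))))) fun e => ?_
    obtain ⟨b, hb, hiff⟩ := hdec (T e) _ _ (hTp e) (encode ((0, []) : ℕ × List ℕ))
    exact ⟨b, hb, hiff.trans ⟨hat e, fun h => subsingleton_pi_pinchedCube_haltScale h _⟩⟩
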